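/- **Setting.** A *link* is a finite undirected graph $G=(\mathcal V,\mathcal E)$ with node features $\mathbf X^0\in\mathbb R^{\mathcal V\times f}$ and an ordered query pair $u\neq v$ of nodes. Let $\mathcal N^j(w)$ be the set of nodes at exactly $j$ hops from $w$, $\mathcal N^j(u,v)=\mathcal N^j(u)\cup\mathcal N^j(v)$, and let $N^m(u,v)$ be the *$m$-hop enclosing subgraph*, i.e. the subgraph induced on $\bigcup_{j=0}^m\mathcal N^j(u,v)$, with its features and the query pair. A model of the $k_\phi$-$k_\rho$-$m$ framework has an output of the form $$F(u,v)=\mathrm{COMB}\Big(g(\phi(u),\phi(v)),\ \mathrm{AGG}\{\psi(\rho(i,h(u,v,\mathbf X^0)),u,v)\mid i\in \textstyle\bigcup_{j=0}^m\mathcal N^j(u,v)\}\Big).$$ For the two models below the endpoint part $g(\phi(u),\phi(v))$ is absent, and $h,\rho,\psi$ are evaluated on $N^m(u,v)$. *SEAL (with parameter $m$).* $\mathrm{AGG}=\sum$, $\psi(z)=z$, $h$ gives $\mathbf x_i^0\,\|\,\lambda(\delta(i,u),\delta(i,v))$, where $\delta$ is the distance in $N^m(u,v)$ and $\lambda$ is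 any labelling function (for instance double radius node labels, or $\min(\delta(i,u),\delta(i,v))+1$), and $\rho$ is any node encoder of expressive power at most $1\text{-}|N^m(u,v)|\text{-WL}$: $\rho$ agrees on two nodes whenever, for every number of rounds, they get the same multiset of 1-WL colors over all assignments of distinct labels $1,\dots,n$ to the $n$ nodes of their graph. *PENCIL with local relational pooling (with parameters $m$, $N_{\max}$).* For an indexing $\pi$ of the $N\le N_{\max}$ nodes of $N^m(u,v)$ by $0,\dots,N-1$ with $\pi(u)=0$, $\pi(v)=1$, the tokens are the $N$ context tokens with encoding [one-hot index, adjacency row, $(1,0)$] (both parts padded to length $N_{\max}$) and two task tokens that copy the encodings of $u$ and $v$ with the flag $(0,1)$. With $\tilde{\mathbf X}$ the matrix of the token encodings, $\mathbf X$ the node features (copied to the task tokens) and $\mathbf G$ an affine feature encoder, $$\mathbf H^{(0)}=\tilde{\mathbf X}\mathbf W_0+\mathbf G(\mathbf X),\qquad \mathbf Z^{(k)}=\mathbf T_k(\mathbf H^{(k-1)}),\qquad \mathbf H^{(k)}=\mathbf Z^{(k)}+\mathbf P_k(\tilde{\mathbf A}\mathbf Z^{(k)})\quad(1\le k\le K),$$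 where $\mathbf T_k$ is a bidirectional Transformer block (multi-head softmax attention, then a one-hidden-layer GELU feed-forward network, each with a skip connection and followed by a normalization), $\mathbf P_k$ is affine on tokens, and $\tilde{\mathbf A}$ is the sum of the adjacency and one-hot parts of $\tilde{\mathbf X}$, restricted to the first $N$ columns, followed by two zero columns for the task tokens. The normalization is a fixed design choice: either none, or layer normalization with stabilizer $\varepsilon>0$ and learnable gain and bias. The vectors $z_i^\pi$ (final representation of the task token for $i=u,v$, and of the context token for the other nodes) are averaged over all such indexings $\pi$ to give $\rho(i)$. Further $\psi$ sends $\rho(i)$ to $[\mathbb 1(i=u)\rho(i)\,\|\,\mathbb 1(i=v)\rho(i)]$, $\mathrm{AGG}=\sum$, and an affine projection to a scalar gives the output. The parameters are all weights and biases, $K$, the hidden and feed-forward widths, and the number and size of the heads. **Theorem.** Fix $f$, $m$, $N_{\max}$ and the choice of normalization. Consider links whose $m$-hop enclosing subgraph has at most $N_{\max}$ nodes. Then PENCIL with local relational pooling is not less expressive than SEAL under this same sampling constraint: 1. For any two such links, if some SEAL model with parameter $m$ gives them different outputs, then there are parameters for which PENCIL with local relational pooling gives them different outputs. 2. For every finite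 set $\mathcal X\subset\mathbb R^f$ of feature vectors there is one parameter setting of PENCIL with local relational pooling that gives different outputs to any two such links, with all node features of their enclosing subgraphs in $\mathcal X$, to which some SEAL model with parameter $m$ gives different outputs. -/

import Mathlib

open scoped BigOperators

noncomputable section

namespace PencilLink

/-! ## Graphs with a query pair and the `m`-hop enclosing subgraph -/

/-- A finite undirected graph with `f` real features per node, together with a query pair of
distinct nodes. -/
structure Link (f : ℕ) where
  V : Type
  [fin : Fintype V]
  G : SimpleGraph V
  X : V → Fin f → ℝ
  u : V
  v : V
  ne : u ≠ v

attribute [instance] Link.fin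

/-- The nodes at exactly `j` hops from `w`. -/
def hop {V : Type} (G : SimpleGraph V) (j : ℕ) (w : V) : Set V :=
  {i | G.edist w i = (j : ℕ∞)}

/-- The joint `j`-hop neighborhood of a pair. -/
def jointHop {V : Type} (G : SimpleGraph V) (j : ℕ) (u v : V) : Set V :=
  hop G j u ∪ hop G j v

/-- The union of the joint `j`-hop neighborhoods over `0 ≤ j ≤ m`. -/
def enclosingSet {V : Type} (G : SimpleGraph V) (m : ℕ) (u v : V) : Set V :=
  ⋃ j ∈ Finset.range (m + 1), jointHop G j u v

theorem left_mem_enclosingSet {V : Type} (G : SimpleGraph V) (m : ℕ) (u v : V) :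
    u ∈ enclosingSet G m u v := by
  simp only [enclosingSet, Set.mem_iUnion]
  exact ⟨0, by simp, Or.inl (by simp [hop])⟩

theorem right_mem_enclosingSet {V : Type} (G : SimpleGraph V) (m : ℕ) (u v : V) :
    v ∈ enclosingSet G m u v := by
  simp only [enclosingSet, Set.mem_iUnion]
  exact ⟨0, by simp, Or.inr (by simp [hop])⟩

/-- The `m`-hop enclosing subgraph of the query pair: the induced subgraph on `enclosingSet`,
with the same query pair and the restricted node features. -/
def Link.enclosing {f : ℕ} (m : ℕ) (L : Link f) : Link f where
  V := enclosingSet L.G m L.u L.v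
  fin := Fintype.ofFinite _
  G := L.G.induce (enclosingSet L.G m L.u L.v)
  X := fun i => L.X i.1
  u := ⟨L.u, left_mem_enclosingSet L.G m L.u L.v⟩
  v := ⟨L.v, right_mem_enclosingSet L.G m L.u L.v⟩
  ne := fun h => L.ne (congrArg Subtype.val h)

/-- The same graph and query pair with another node-feature matrix. -/
abbrev Link.withFeatures {f c : ℕ} (L : Link f) (Y : L.V → Fin c → ℝ) : Link c where
  V := L.V
  fin := L.fin
  G := L.G
  X := Y
  u := L.u
  v := L.v
  ne := L.ne

/-! ## Color refinement with `|V|` distinct node labels -/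

/-- Colors after `t` rounds of color refinement with initial colors in `C`. -/
def WLColor (C : Type) : ℕ → Type
  | 0 => C
  | t + 1 => WLColor C t × Multiset (WLColor C t)

open scoped Classical in
/-- 1-WL: a new color is the old one together with the multiset of the colors of the neighbors. -/
def wlColor {V C : Type} [Fintype V] (G : SimpleGraph V) (x : V → C) :
    (t : ℕ) → V → WLColor C t
  | 0, i => x i
  | t + 1, i => (wlColor G x t i, (G.neighborFinset i).val.map (wlColor G x t))

open scoped Classical in
/-- The `1-|V|`-WL color of a node after `t` rounds: for every assignment of the distinct labels
`0, …, |V| - 1` to all nodes run 1-WL with the features and the labels as initial colors, and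
collect the multiset of the colors that the node gets. -/
def labelledWLColor {c : ℕ} (L : Link c) (t : ℕ) (i : L.V) :
    Multiset (WLColor ((Fin c → ℝ) × ℕ) t) :=
  (Finset.univ : Finset (L.V ≃ Fin (Fintype.card L.V))).val.map
    (fun ℓ => wlColor L.G (fun w => (L.X w, ((ℓ w : Fin _) : ℕ))) t i)

/-- A node encoder: it assigns a vector to every node of a featured graph with a query pair. -/
abbrev NodeEncoder (c e : ℕ) : Type 1 := (L : Link c) → L.V → Fin e → ℝ

/-- The encoder separates at most the nodes that `1-|V|`-WL separates. -/
def NodeEncoder.PowerLabelledWL {c e : ℕ} (ρ : NodeEncoder c e) : Prop :=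
  ∀ (L L' : Link c) (i : L.V) (i' : L'.V),
    (∀ t, labelledWLColor L t i = labelledWLColor L' t i') → ρ L i = ρ L' i'

/-! ## The `k_φ`-`k_ρ`-`m` framework -/

/-- The components of a model in the framework. The derived features `h`, the encoder `ρ` and
the rescaling `ψ` act on the `m`-hop enclosing subgraph. -/
structure FrameworkModel (f : ℕ) where
  m : ℕ
  (dφ dg dh dρ dψ dagg out : ℕ)
  φ : NodeEncoder f dφ
  g : (Fin dφ → ℝ) → (Fin dφ → ℝ) → Fin dg → ℝ
  h : (L : Link f) → L.V → Fin dh → ℝ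
  ρ : NodeEncoder dh dρ
  ψ : (L : Link f) → L.V → (Fin dρ → ℝ) → Fin dψ → ℝ
  AGG : Multiset (Fin dψ → ℝ) → Fin dagg → ℝ
  COMB : (Fin dg → ℝ) → (Fin dagg → ℝ) → Fin out → ℝ

/-- `COMB (g (φ u) (φ v)) (AGG {ψ (ρ (i, h (u, v, X⁰)), u, v) | i})`. -/
def FrameworkModel.eval {f : ℕ} (M : FrameworkModel f) (L : Link f) : Fin M.out → ℝ :=
  let E := L.enclosing M.m
  M.COMB (M.g (M.φ L L.u) (M.φ L L.v))
    (M.AGG ((Finset.univ : Finset E.V).val.map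
      fun i => M.ψ E i (M.ρ (E.withFeatures (M.h E)) i)))

/-- On the links in `D`, every pair of links that some model of `ℬ` separates is separated by
some model of `𝒜`. -/
def NotLessExpressive {f : ℕ} (𝒜 ℬ : Set (FrameworkModel f)) (D : Set (Link f)) : Prop :=
  ∀ L ∈ D, ∀ L' ∈ D, (∃ M ∈ ℬ, M.eval L ≠ M.eval L') → ∃ M ∈ 𝒜, M.eval L ≠ M.eval L'

/-! ## SEAL -/

/-- The distance-aware features: the node features extended by a label computed from the two
distances to the query nodes. -/
def distFeatures {f : ℕ} (lab : ℕ∞ → ℕ∞ → ℝ) (L : Link f) (i : L.V) : Fin (f + 1) → ℝ :=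
  Fin.snoc (α := fun _ => ℝ) (L.X i) (lab (L.G.edist i L.u) (L.G.edist i L.v))

/-- SEAL: no endpoint encoder, derived features `distFeatures`, identity rescaling, sum. -/
def sealModel {f e : ℕ} (m : ℕ) (lab : ℕ∞ → ℕ∞ → ℝ) (ρ : NodeEncoder (f + 1) e) :
    FrameworkModel f where
  m := m
  dφ := 0
  dg := 0
  dh := f + 1
  dρ := e
  dψ := e
  dagg := e
  out := e
  φ := fun _ _ => 0
  g := fun _ _ => 0
  h := distFeatures lab
  ρ := ρ
  ψ := fun _ _ z => z
  AGG := fun s => s.sum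
  COMB := fun _ y => y

/-- All SEAL models with locality parameter `m`. Double radius node labels and
`min (δ (i, u)) (δ (i, v)) + 1` are particular choices of `lab`, and every message passing
network on the labelled subgraph is a particular choice of `ρ`. -/
def sealFamily (f m : ℕ) : Set (FrameworkModel f) :=
  {M | ∃ (lab : ℕ∞ → ℕ∞ → ℝ) (e : ℕ) (ρ : NodeEncoder (f + 1) e),
    ρ.PowerLabelledWL ∧ M = sealModel m lab ρ}

/-! ## PENCIL -/

/-- The normalization after each sublayer of a Transformer block: none, or layer normalization
with stabilizer `ε` and learnable gain and bias, as in BERT. -/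
inductive Normalization where
  | none
  | layer (ε : ℝ) (hε : 0 < ε)

def Normalization.apply {d : ℕ} (nrm : Normalization) (γ β x : Fin d → ℝ) : Fin d → ℝ :=
  match nrm with
  | .none => x
  | .layer ε _ =>
    let μ := (∑ j, x j) / d
    let σ2 := (∑ j, (x j - μ) ^ 2) / d
    fun j => γ j * ((x j - μ) / Real.sqrt (σ2 + ε)) + β j

/-- The Gaussian error linear unit `x ↦ x Φ(x)`. -/
def gelu (x : ℝ) : ℝ :=
  x * ProbabilityTheory.cdf (ProbabilityTheory.gaussianReal 0 1) x

/-- Parameters of one block with hidden size `d`: multi-head attention (query, key, value and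
output maps), feed-forward network, normalizations, and the post-propagation projection. -/
structure BlockParams (d : ℕ) where
  (heads dk ff : ℕ)
  (WQ WK WV : Fin heads → Matrix (Fin d) (Fin dk) ℝ)
  (bQ bK bV : Fin heads → Fin dk → ℝ)
  WO : Matrix (Fin heads × Fin dk) (Fin d) ℝ
  bO : Fin d → ℝ
  W₁ : Matrix (Fin d) (Fin ff) ℝ
  b₁ : Fin ff → ℝ
  W₂ : Matrix (Fin ff) (Fin d) ℝ
  b₂ : Fin d → ℝ
  (γ₁ β₁ γ₂ β₂ : Fin d → ℝ)
  WP : Matrix (Fin d) (Fin d) ℝ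
  bP : Fin d → ℝ

/-- Bidirectional multi-head softmax self-attention over the tokens `τ`. -/
def BlockParams.attention {d : ℕ} {τ : Type} [Fintype τ] (B : BlockParams d)
    (H : Matrix τ (Fin d) ℝ) : Matrix τ (Fin d) ℝ := fun t j =>
  let q : Fin B.heads → τ → Fin B.dk → ℝ := fun a s c => (H * B.WQ a) s c + B.bQ a c
  let k : Fin B.heads → τ → Fin B.dk → ℝ := fun a s c => (H * B.WK a) s c + B.bK a c
  let w : Fin B.heads → τ → Fin B.dk → ℝ := fun a s c => (H * B.WV a) s c + B.bV a c
  let logit : Fin B.heads → τ → ℝ := fun a s =>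
    (∑ c, q a t c * k a s c) / Real.sqrt B.dk
  let weight : Fin B.heads → τ → ℝ := fun a s =>
    Real.exp (logit a s) / ∑ s', Real.exp (logit a s')
  (∑ p : Fin B.heads × Fin B.dk, (∑ s, weight p.1 s * w p.1 s p.2) * B.WO p j) + B.bO j

/-- The position-wise feed-forward network with one hidden layer. -/
def BlockParams.feedForward {d : ℕ} (B : BlockParams d) (x : Fin d → ℝ) : Fin d → ℝ := fun j =>
  (∑ c, gelu ((∑ l, x l * B.W₁ l c) + B.b₁ c) * B.W₂ c j) + B.b₂ j

/-- The Transformer block `T`: both sublayers have a skip connection followed by the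
normalization. -/
def BlockParams.transformer {d : ℕ} {τ : Type} [Fintype τ] (nrm : Normalization)
    (B : BlockParams d) (H : Matrix τ (Fin d) ℝ) : Matrix τ (Fin d) ℝ := fun t =>
  let y := nrm.apply B.γ₁ B.β₁ (fun j => H t j + B.attention H t j)
  nrm.apply B.γ₂ B.β₂ (fun j => y j + B.feedForward y j)

/-- One PENCIL block: `Z = T(H)` and then the multiplicative residual `Z + P(Ã Z)`. -/
def BlockParams.block {d : ℕ} {τ : Type} [Fintype τ] (nrm : Normalization) (B : BlockParams d)
    (A : Matrix τ τ ℝ) (H : Matrix τ (Fin d) ℝ) : Matrix τ (Fin d) ℝ :=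
  let Z := B.transformer nrm H
  fun t j => Z t j + ((A * Z * B.WP) t j + B.bP j)

/-- Tokens of a subgraph with `N` nodes: `N` context tokens and two task tokens. -/
abbrev Token (N : ℕ) : Type := Fin N ⊕ Fin 2

/-- Columns of the token encoding: identifier slots, adjacency slots and the role flag. -/
abbrev Column (Nmax : ℕ) : Type := (Fin Nmax ⊕ Fin Nmax) ⊕ Fin 2

/-- The context node that a token stands for. The two task tokens copy the context nodes with
indices `0` and `1`. -/
def Token.node {N : ℕ} (hN : 2 ≤ N) : Token N → Fin N
  | .inl a => a
  | .inr r => Fin.castLE hN r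

open scoped Classical in
/-- The token encoding of a graph on `Fin N`: padded one-hot identifier, padded adjacency row,
and role flag (`[1,0]` for context tokens, `[0,1]` for task tokens). -/
def encode (Nmax : ℕ) {N : ℕ} (hN : 2 ≤ N) (G : SimpleGraph (Fin N)) :
    Matrix (Token N) (Column Nmax) ℝ := fun t col =>
  match col with
  | .inl (.inl s) => if (s : ℕ) = (t.node hN : Fin N) then 1 else 0
  | .inl (.inr s) => if ∃ b : Fin N, (b : ℕ) = s ∧ G.Adj (t.node hN) b then 1 else 0
  | .inr r =>
    match t with
    | .inl _ => if r = 0 then 1 else 0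
    | .inr _ => if r = 1 then 1 else 0

/-- The operator `Ã` sliced out of a token encoding: adjacency part plus identifier part in the
columns of the context tokens, zero in the columns of the task tokens. -/
def reconstruct {Nmax N : ℕ} (x : Matrix (Token N) (Column Nmax) ℝ) :
    Matrix (Token N) (Token N) ℝ := fun t s =>
  match s with
  | .inl b =>
    if hb : (b : ℕ) < Nmax then x t (.inl (.inr ⟨b, hb⟩)) + x t (.inl (.inl ⟨b, hb⟩)) else 0
  | .inr _ => 0

/-- Parameters of PENCIL with sampling budget `Nmax` and `f` node features. `WG`, `bG` are the
feature encoder, and `head`, `bhead` the final projection of the two concatenated endpoint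
representations. -/
structure PencilParams (f Nmax : ℕ) where
  (d K : ℕ)
  W₀ : Matrix (Column Nmax) (Fin d) ℝ
  WG : Matrix (Fin f) (Fin d) ℝ
  bG : Fin d → ℝ
  blocks : Fin K → BlockParams d
  head : Fin (d + d) → ℝ
  bhead : ℝ

/-- Final token representations `H^(K)` for a featured graph on `Fin N`. -/
def PencilParams.forward {f Nmax N : ℕ} (nrm : Normalization) (P : PencilParams f Nmax)
    (hN : 2 ≤ N) (G : SimpleGraph (Fin N)) (X : Fin N → Fin f → ℝ) :
    Matrix (Token N) (Fin P.d) ℝ :=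
  let x := encode Nmax hN G
  let H₀ : Matrix (Token N) (Fin P.d) ℝ := fun t j =>
    (x * P.W₀) t j + ((∑ l, X (t.node hN) l * P.WG l j) + P.bG j)
  (List.ofFn P.blocks).foldl (fun H B => B.block nrm (reconstruct x) H) H₀

theorem Link.two_le_card {f : ℕ} (L : Link f) : 2 ≤ Fintype.card L.V :=
  Fintype.one_lt_card_iff.mpr ⟨L.u, L.v, L.ne⟩

open scoped Classical in
/-- The endpoint-constrained relabelings: the query nodes get the indices `0` and `1`. -/
def relabelings {f : ℕ} (L : Link f) : Finset (L.V ≃ Fin (Fintype.card L.V)) :=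
  Finset.univ.filter fun π => ((π L.u : Fin _) : ℕ) = 0 ∧ ((π L.v : Fin _) : ℕ) = 1

open scoped Classical in
/-- The token at which a node is read out: the two query nodes at their task tokens, every other
node at its context token. -/
def readToken {f : ℕ} (L : Link f) (π : L.V ≃ Fin (Fintype.card L.V)) (i : L.V) :
    Token (Fintype.card L.V) :=
  if i = L.u then .inr 0 else if i = L.v then .inr 1 else .inl (π i)

/-- The node representations of PENCIL with local relational pooling: the average, over all
endpoint-constrained relabelings, of the representations for the relabeled subgraph. -/
def PencilParams.pooled {f Nmax : ℕ} (nrm : Normalization) (P : PencilParams f Nmax) :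
    NodeEncoder f P.d := fun L i j =>
  (∑ π ∈ relabelings L,
      P.forward nrm L.two_le_card (L.G.comap π.symm) (fun a => L.X (π.symm a))
        (readToken L π i) j) / (relabelings L).card

open scoped Classical in
/-- PENCIL with local relational pooling: no endpoint encoder, the gated rescaling
`z ↦ [𝟙(i = u) z ‖ 𝟙(i = v) z]`, sum, and the final linear projection to the link logit. -/
def pencilModel {f Nmax : ℕ} (m : ℕ) (nrm : Normalization) (P : PencilParams f Nmax) :
    FrameworkModel f where
  m := m
  dφ := 0
  dg := 0
  dh := f
  dρ := P.d
  dψ := P.d + P.d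
  dagg := P.d + P.d
  out := 1
  φ := fun _ _ => 0
  g := fun _ _ => 0
  h := fun L => L.X
  ρ := P.pooled nrm
  ψ := fun L i z =>
    Fin.append (fun j => if i = L.u then z j else 0) (fun j => if i = L.v then z j else 0)
  AGG := fun s => s.sum
  COMB := fun _ y _ => (∑ j, P.head j * y j) + P.bhead

/-- All PENCIL models with pooling, locality parameter `m` and sampling budget `Nmax`. -/
def pencilFamily (f Nmax m : ℕ) (nrm : Normalization) : Set (FrameworkModel f) :=
  {M | ∃ P : PencilParams f Nmax, M = pencilModel m nrm P}

/-- The links whose `m`-hop enclosing subgraph has at most `Nmax` nodes. -/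
def withinBudget (f Nmax m : ℕ) : Set (Link f) :=
  {L | Fintype.card (L.enclosing m).V ≤ Nmax}

/-- The links whose enclosing subgraph has all its node features in the set `𝒳`. -/
def featuresIn {f : ℕ} (m : ℕ) (𝒳 : Set (Fin f → ℝ)) : Set (Link f) :=
  {L | ∀ i : (L.enclosing m).V, (L.enclosing m).X i ∈ 𝒳}

end PencilLink

end

/-!
A SEAL output depends only on the isomorphism class of the enclosing subgraph with its features and
its ordered query pair (`sealModel_eval_eq_of_linkIso`). So it is enough to find one parameter
setting of PENCIL that gives different outputs to any two nonisomorphic enclosing subgraphs of at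
most `Nmax` nodes with features in a finite set (`exists_pencilModel_eval_ne`); for a single pair of
links the features that occur form such a set.

One block of hidden size `2` suffices, with the second coordinate always `0` so that layer
normalization acts on the first one as an injective map comparable to a linear one near `0`.

* A generic linear functional maps the finitely many possible token encodings injectively to real
  codes, and the set of the codes of all tokens determines the labelled graph
  (`labelled_eq_of_range_tokenVec_eq`).
* One attention head computes the softmax mean of the code set `A` at inverse temperature `R`. This
  is the logarithmic derivative in `R` of `∑ c ∈ A, exp (R * c)`, and exponentials are linearly
  independent, so distinct code sets have distinct analytic functions of `R`, and some `R` separates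
  finitely many code sets (`exists_softmaxMean_injOn`). A generic factor `κ` on the head keeps them
  separated in the presence of the skip connection.
* In the feed-forward network, `gelu x - gelu (-x) = x` cancels the second skip connection, and the
  remaining unit uses that `gelu` decays on the negative axis like a Gaussian tail: after a large
  rescaling, its values at distinct points are of different orders of magnitude
  (`eventually_mul_gelu_neg_lt`).
* Nonisomorphic links have no relabelling in common, so the values averaged for one and for the
  other are of different orders of magnitude. Averaging at most `Nmax!` values changes the largest
  one by at most the factor `Nmax!`, so the two averages differ (`average_ne_of_separated`).
-/

noncomputable section

namespace PencilLink

open Filter Topology ProbabilityTheory MeasureTheory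

/-! ### The Gaussian error linear unit -/

theorem gaussianCDF_add_neg (x : ℝ) :
    cdf (gaussianReal 0 1) x + cdf (gaussianReal 0 1) (-x) = 1 := by
  have h : (gaussianReal 0 1).real (Set.Iic (-x)) = (gaussianReal 0 1).real (Set.Ici x) := by
    conv_lhs => rw [show gaussianReal 0 1 = (gaussianReal 0 1).map (fun y : ℝ => -y) by
      rw [gaussianReal_map_neg, neg_zero]]
    rw [map_measureReal_apply measurable_neg measurableSet_Iic]
    congr 1
    ext y
    simp
  have := nullSingletonClass_gaussianReal (μ := 0) (v := 1) one_ne_zero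
  rw [cdf_eq_real, cdf_eq_real, h, measureReal_congr (Ioi_ae_eq_Ici (μ := gaussianReal 0 1)).symm,
    ← Set.compl_Iic]
  exact probReal_add_probReal_compl measurableSet_Iic

theorem gaussianCDF_pos (x : ℝ) : 0 < cdf (gaussianReal 0 1) x := by
  rw [cdf_eq_real, measureReal_def, ENNReal.toReal_pos_iff]
  refine ⟨pos_iff_ne_zero.mpr fun h => ?_, measure_lt_top _ _⟩
  have := gaussianReal_absolutelyContinuous' 0 (v := 1) one_ne_zero h
  simp at this

/-- The Gaussian tail loses at least a factor `exp (-(x * h))` from `x` to `x + h`. -/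
theorem gaussianCDF_tail_shift (x : ℝ) {h : ℝ} (hh : 0 ≤ h) :
    cdf (gaussianReal 0 1) (-(x + h)) ≤ Real.exp (-(x * h)) * cdf (gaussianReal 0 1) (-x) := by
  -- Shifting by `h` multiplies the density at `y ≤ -x` by `exp (y * h - h ^ 2 / 2)`.
  have hshift : (gaussianReal 0 1).real (Set.Iic (-(x + h)))
      = (gaussianReal h 1).real (Set.Iic (-x)) := by
    have := gaussianReal_map_add_const (μ := 0) (v := 1) h
    rw [zero_add] at this
    rw [← this, map_measureReal_apply (by fun_prop) measurableSet_Iic]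
    congr 1
    ext y
    simp only [Set.mem_Iic, Set.mem_preimage]
    constructor <;> intro <;> linarith
  have hreal (μ : ℝ) : (gaussianReal μ 1).real (Set.Iic (-x))
      = ∫ y in Set.Iic (-x), gaussianPDFReal μ 1 y := by
    rw [measureReal_def, gaussianReal_apply_eq_integral _ one_ne_zero, ENNReal.toReal_ofReal]
    exact integral_nonneg fun y => gaussianPDFReal_nonneg _ _ _
  rw [cdf_eq_real, cdf_eq_real, hshift, hreal, hreal, ← integral_const_mul]
  refine setIntegral_mono_on (integrable_gaussianPDFReal h 1).integrableOn
    ((integrable_gaussianPDFReal 0 1).const_mul _).integrableOn measurableSet_Iic fun y hy => ?_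
  rw [gaussianPDFReal, gaussianPDFReal, mul_left_comm, ← Real.exp_add]
  refine mul_le_mul_of_nonneg_left (Real.exp_le_exp.mpr ?_) (by positivity)
  rw [Set.mem_Iic] at hy
  simp only [NNReal.coe_one]
  nlinarith [mul_le_mul_of_nonneg_right hy hh]

theorem gelu_sub_gelu_neg (x : ℝ) : gelu x - gelu (-x) = x := by
  have h := gaussianCDF_add_neg x
  unfold gelu
  linear_combination x * h

theorem gelu_neg_pos {x : ℝ} (hx : 0 < x) : 0 < -gelu (-x) := by
  have := mul_pos hx (gaussianCDF_pos (-x))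
  unfold gelu
  linarith

/-- On the negative axis `gelu` decays so fast that, after a large rescaling, its values at
distinct points are of different orders of magnitude. -/
theorem eventually_mul_gelu_neg_lt (C : ℝ) {x y : ℝ} (hx : 0 < x) (hxy : x < y) :
    ∀ᶠ r : ℝ in atTop, C * -gelu (-(r * y)) < -gelu (-(r * x)) := by
  have hlim : Tendsto (fun r : ℝ => |C| * (y / x) * Real.exp (-(r * (x * (y - x))))) atTop
      (𝓝 (|C| * (y / x) * 0)) := by
    refine Tendsto.const_mul _ (Real.tendsto_exp_neg_atTop_nhds_zero.comp ?_)
    exact tendsto_id.atTop_mul_const (mul_pos hx (sub_pos.mpr hxy))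
  rw [mul_zero] at hlim
  filter_upwards [hlim.eventually (gt_mem_nhds one_pos), eventually_ge_atTop 1] with r hr hr1
  have hr0 : 0 < r := by linarith
  have hrx : 0 < r * x := mul_pos hr0 hx
  have htail := gaussianCDF_tail_shift (r * x) (h := r * (y - x))
    (mul_nonneg hr0.le (sub_pos.mpr hxy).le)
  rw [show r * x + r * (y - x) = r * y by ring] at htail
  have hexp : Real.exp (-(r * x * (r * (y - x)))) ≤ Real.exp (-(r * (x * (y - x)))) := by
    refine Real.exp_le_exp.mpr ?_
    have : 0 < r * (x * (y - x)) := by have := sub_pos.mpr hxy; positivity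
    nlinarith
  have hpos := gaussianCDF_pos (-(r * x))
  set p := cdf (gaussianReal 0 1) (-(r * x))
  have hy : 0 < r * y := mul_pos hr0 (hx.trans hxy)
  calc C * -gelu (-(r * y)) ≤ |C| * -gelu (-(r * y)) :=
        mul_le_mul_of_nonneg_right (le_abs_self C) (gelu_neg_pos hy).le
    _ = |C| * (r * y * cdf (gaussianReal 0 1) (-(r * y))) := by rw [gelu]; ring
    _ ≤ |C| * (r * y * (Real.exp (-(r * (x * (y - x)))) * p)) := by
        gcongr
        exact htail.trans (mul_le_mul_of_nonneg_right hexp hpos.le)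
    _ = |C| * (y / x) * Real.exp (-(r * (x * (y - x)))) * (r * x * p) := by
        field_simp
    _ < 1 * (r * x * p) := mul_lt_mul_of_pos_right hr (mul_pos hrx hpos)
    _ = -gelu (-(r * x)) := by rw [gelu]; ring

/-! ### Softmax averages of finite sets of reals -/

/-- The mean of the elements of `A` with the softmax weights at inverse temperature `R`. -/
def softmaxMean (R : ℝ) (A : Finset ℝ) : ℝ :=
  (∑ c ∈ A, c * Real.exp (R * c)) / ∑ c ∈ A, Real.exp (R * c)

theorem sum_exp_pos {A : Finset ℝ} (hA : A.Nonempty) (R : ℝ) :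
    0 < ∑ c ∈ A, Real.exp (R * c) :=
  Finset.sum_pos (fun _ _ => Real.exp_pos _) hA

theorem hasDerivAt_sum_exp (A : Finset ℝ) (R : ℝ) :
    HasDerivAt (fun R : ℝ => ∑ c ∈ A, Real.exp (R * c)) (∑ c ∈ A, c * Real.exp (R * c)) R := by
  refine HasDerivAt.fun_sum fun c _ => ?_
  simpa [mul_comm] using ((hasDerivAt_id R).mul_const c).exp

theorem linearIndependent_exp :
    LinearIndependent ℝ (fun (c : ℝ) (R : ℝ) => Real.exp (R * c)) := by
  let χ : ℝ → (Multiplicative ℝ →* ℝ) := fun c =>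
    { toFun := fun R => Real.exp (R.toAdd * c)
      map_one' := by simp
      map_mul' := fun a b => by simp [add_mul, Real.exp_add] }
  have hχ : Function.Injective χ := fun a b h => by
    have := DFunLike.congr_fun h (Multiplicative.ofAdd 1)
    simpa [χ] using this
  exact (linearIndependent_monoidHom (Multiplicative ℝ) ℝ).comp χ hχ

/-- Proportional sums of exponentials over two finite sets have the same exponents. -/
theorem eq_of_sum_exp_eq_mul {A B : Finset ℝ} (hA : A.Nonempty) (C : ℝ)
    (h : ∀ R : ℝ, ∑ c ∈ A, Real.exp (R * c) = C * ∑ c ∈ B, Real.exp (R * c)) : A = B := by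
  classical
  have hli := linearIndependent_iff'.mp linearIndependent_exp (A ∪ B)
    (fun c => (if c ∈ A then 1 else 0) - C * (if c ∈ B then 1 else 0)) (by
      funext R
      have := h R
      simp only [Finset.sum_apply, Pi.smul_apply, smul_eq_mul, Pi.zero_apply, sub_mul, ite_mul,
        one_mul, zero_mul, mul_assoc, Finset.sum_sub_distrib, ← Finset.mul_sum,
        Finset.sum_ite_mem, Finset.union_inter_cancel_left, Finset.union_inter_cancel_right]
      linarith)
  have hC : C ≠ 0 := by
    rintro rfl
    obtain ⟨a, ha⟩ := hA
    simpa [ha] using hli a (Finset.mem_union_left _ ha)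
  ext c
  by_cases hc : c ∈ A ∪ B
  · have := hli c hc
    by_cases h1 : c ∈ A <;> by_cases h2 : c ∈ B <;> simp_all
  · simp_all

/-- The softmax mean is the logarithmic derivative of `R ↦ ∑ c ∈ A, exp (R * c)`, which
determines `A`. -/
theorem eq_of_softmaxMean_eq {A B : Finset ℝ} (hA : A.Nonempty) (hB : B.Nonempty)
    (h : ∀ R, softmaxMean R A = softmaxMean R B) : A = B := by
  have hd (R : ℝ) := (hasDerivAt_sum_exp A R).div (hasDerivAt_sum_exp B R) (sum_exp_pos hB R).ne'
  have hconst := is_const_of_deriv_eq_zero (fun R => (hd R).differentiableAt) fun R => by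
    rw [(hd R).deriv]
    -- The numerator of the derivative of the quotient vanishes.
    have h1 := (div_eq_div_iff (sum_exp_pos hA R).ne' (sum_exp_pos hB R).ne').mp (h R)
    rw [h1]
    simp [mul_comm]
  refine eq_of_sum_exp_eq_mul hA ((∑ c ∈ A, Real.exp (0 * c)) / ∑ c ∈ B, Real.exp (0 * c))
    fun R => ?_
  have := hconst R 0
  simp only [Pi.div_apply] at this
  rw [← this, div_mul_cancel₀ _ (sum_exp_pos hB R).ne']

theorem analyticAt_softmaxMean {A : Finset ℝ} (hA : A.Nonempty) (R : ℝ) :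
    AnalyticAt ℝ (fun R => softmaxMean R A) R := by
  unfold softmaxMean
  refine AnalyticAt.div ?_ ?_ (sum_exp_pos hA R).ne'
  · exact Finset.analyticAt_fun_sum _ fun c _ => by fun_prop
  · exact Finset.analyticAt_fun_sum _ fun c _ => by fun_prop

/-- One temperature separates all nonempty subsets of a finite set of reals. -/
theorem exists_softmaxMean_injOn (Ω : Finset ℝ) :
    ∃ R : ℝ, ∀ A ⊆ Ω, ∀ B ⊆ Ω, A.Nonempty → B.Nonempty →
      softmaxMean R A = softmaxMean R B → A = B := by
  have key : ∀ A ∈ Ω.powerset, ∀ B ∈ Ω.powerset, ∀ᶠ R : ℝ in 𝓝[≠] 0, A.Nonempty → B.Nonempty →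
      softmaxMean R A = softmaxMean R B → A = B := by
    intro A _ B _
    by_cases hA : A.Nonempty
    swap; · exact Eventually.of_forall fun _ h => absurd h hA
    by_cases hB : B.Nonempty
    swap; · exact Eventually.of_forall fun _ _ h => absurd h hB
    rcases (analyticAt_softmaxMean hA 0).eventually_eq_or_eventually_ne
      (analyticAt_softmaxMean hB 0) with h0 | h0
    · have hAB : A = B := eq_of_softmaxMean_eq hA hB <| congrFun <|
        AnalyticOnNhd.eq_of_eventuallyEq (fun R _ => analyticAt_softmaxMean hA R)
          (fun R _ => analyticAt_softmaxMean hB R) h0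
      exact Eventually.of_forall fun _ _ _ _ => hAB
    · filter_upwards [h0] with R hR _ _ h
      exact absurd h hR
  have hall : ∀ᶠ R : ℝ in 𝓝[≠] 0, ∀ A ∈ Ω.powerset, ∀ B ∈ Ω.powerset, A.Nonempty →
      B.Nonempty → softmaxMean R A = softmaxMean R B → A = B := by
    refine (Ω.powerset.eventually_all).mpr fun A hA => ?_
    exact (Ω.powerset.eventually_all).mpr fun B hB => key A hA B hB
  obtain ⟨R, hR⟩ := hall.exists
  exact ⟨R, fun A hA B hB => hR A (Finset.mem_powerset.mpr hA) B (Finset.mem_powerset.mpr hB)⟩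

/-! ### Separation by orders of magnitude -/

theorem average_lt_average {ι κ : Type*} {s : Finset ι} {t : Finset κ} (hs : s.Nonempty)
    {a : ι → ℝ} {b : κ → ℝ} {M : ℝ} (htM : (t.card : ℝ) ≤ M) (hb : ∀ j ∈ t, 0 < b j) {i : ι}
    {j : κ} (hi : ∀ i' ∈ s, a i' ≤ a i) (hj : j ∈ t) (h : M * a i < b j) :
    (∑ i ∈ s, a i) / s.card < (∑ j ∈ t, b j) / t.card := by
  have hs' : (0 : ℝ) < s.card := by exact_mod_cast hs.card_pos
  have ht' : (0 : ℝ) < t.card := by exact_mod_cast Finset.card_pos.mpr ⟨j, hj⟩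
  have hM : 0 < M := ht'.trans_le htM
  have hbj := hb j hj
  calc (∑ i ∈ s, a i) / s.card ≤ a i := by
        rw [div_le_iff₀ hs', mul_comm, ← nsmul_eq_mul]
        exact Finset.sum_le_card_nsmul _ _ _ hi
    _ < b j / M := by rwa [lt_div_iff₀ hM, mul_comm]
    _ ≤ b j / t.card := by gcongr
    _ ≤ (∑ j ∈ t, b j) / t.card := by
        gcongr
        exact Finset.single_le_sum (f := b) (fun j hj => (hb j hj).le) hj

/-- If of any two values, one from each family, one exceeds `M` times the other, and neither
family has more than `M` members, then the averages of the two families differ: the family with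
the largest value overall has the larger average. -/
theorem average_ne_of_separated {ι κ : Type*} {s : Finset ι} {t : Finset κ} (hs : s.Nonempty)
    (ht : t.Nonempty) {a : ι → ℝ} {b : κ → ℝ} {M : ℝ} (hsM : (s.card : ℝ) ≤ M)
    (htM : (t.card : ℝ) ≤ M) (ha : ∀ i ∈ s, 0 < a i) (hb : ∀ j ∈ t, 0 < b j)
    (hab : ∀ i ∈ s, ∀ j ∈ t, M * a i < b j ∨ M * b j < a i) :
    (∑ i ∈ s, a i) / s.card ≠ (∑ j ∈ t, b j) / t.card := by
  obtain ⟨i, hi, hmaxi⟩ := Finset.exists_max_image s a hs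
  obtain ⟨j, hj, hmaxj⟩ := Finset.exists_max_image t b ht
  rcases hab i hi j hj with h | h
  · exact (average_lt_average hs htM hb hmaxi hj h).ne
  · exact (average_lt_average ht hsM ha hmaxj hi h).ne'

/-! ### SEAL is invariant under isomorphisms of enclosing subgraphs -/

/-- An isomorphism of featured graphs with a query pair. -/
structure LinkIso {c : ℕ} (L L' : Link c) where
  iso : L.G ≃g L'.G
  map_X : ∀ i, L'.X (iso i) = L.X i
  map_u : iso L.u = L'.u
  map_v : iso L.v = L'.v

theorem edist_map_le {V W : Type*} {G : SimpleGraph V} {H : SimpleGraph W} (φ : G →g H) (a b : V) :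
    H.edist (φ a) (φ b) ≤ G.edist a b := by
  by_cases h : G.edist a b = ⊤
  · simp [h]
  · obtain ⟨p, hp⟩ := SimpleGraph.exists_walk_of_edist_ne_top h
    rw [← hp, ← p.length_map φ]
    exact (p.map φ).edist_le

theorem edist_iso {V W : Type*} {G : SimpleGraph V} {H : SimpleGraph W} (φ : G ≃g H) (a b : V) :
    H.edist (φ a) (φ b) = G.edist a b := by
  refine le_antisymm (edist_map_le φ.toHom a b) ?_
  simpa using edist_map_le φ.symm.toHom (φ a) (φ b)

theorem wlColor_iso {V W C : Type} [Fintype V] [Fintype W] {G : SimpleGraph V} {H : SimpleGraph W}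
    (φ : G ≃g H) {x : V → C} {y : W → C} (hxy : ∀ i, y (φ i) = x i) (t : ℕ) (i : V) :
    wlColor H y t (φ i) = wlColor G x t i := by
  classical
  induction t generalizing i with
  | zero => exact hxy i
  | succ t ih =>
    refine Prod.ext (ih i) ?_
    have hN : H.neighborFinset (φ i) = (G.neighborFinset i).map φ.toEquiv.toEmbedding := by
      ext w
      obtain ⟨w, rfl⟩ := φ.surjective w
      rw [SimpleGraph.mem_neighborFinset, SimpleGraph.Iso.map_adj_iff,
        ← SimpleGraph.mem_neighborFinset]
      exact (Finset.mem_map' φ.toEquiv.toEmbedding).symm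
    simp only [wlColor]
    rw [← Multiset.map_congr rfl fun j _ => ih j]
    convert congrArg (fun s : Finset W => s.val.map (wlColor H y t)) hN using 1
    rw [Finset.map_val, Multiset.map_map]
    congr!

theorem labelledWLColor_iso {c : ℕ} {L L' : Link c} (φ : LinkIso L L') (t : ℕ) (i : L.V) :
    labelledWLColor L' t (φ.iso i) = labelledWLColor L t i := by
  classical
  have hcard : Fintype.card L.V = Fintype.card L'.V := Fintype.card_congr φ.iso.toEquiv
  let e : (L.V ≃ Fin (Fintype.card L.V)) ≃ (L'.V ≃ Fin (Fintype.card L'.V)) :=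
    Equiv.equivCongr φ.iso.toEquiv (finCongr hcard)
  unfold labelledWLColor
  have huniv : (Finset.univ : Finset (L'.V ≃ Fin (Fintype.card L'.V))).val
      = (Finset.univ : Finset (L.V ≃ Fin (Fintype.card L.V))).val.map e := by
    convert (Multiset.map_univ_val_equiv e).symm
  rw [huniv, Multiset.map_map]
  refine Multiset.map_congr rfl fun ℓ _ => ?_
  refine wlColor_iso φ.iso (fun w => ?_) t i
  exact Prod.ext (φ.map_X w)
    (congrArg (fun v => ((ℓ v : Fin _) : ℕ)) (φ.iso.symm_apply_apply w))

/-- Isomorphic enclosing subgraphs get the same output from every SEAL model. -/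
theorem sealModel_eval_eq_of_linkIso {f e m : ℕ} {lab : ℕ∞ → ℕ∞ → ℝ} {ρ : NodeEncoder (f + 1) e}
    (hρ : ρ.PowerLabelledWL) {L L' : Link f} (φ : LinkIso (L.enclosing m) (L'.enclosing m)) :
    (sealModel m lab ρ).eval L = (sealModel m lab ρ).eval L' := by
  set E := L.enclosing m
  set E' := L'.enclosing m
  let ψ : LinkIso (E.withFeatures (distFeatures lab E)) (E'.withFeatures (distFeatures lab E')) :=
    { iso := φ.iso
      map_X := fun i => by
        simp only [distFeatures]
        rw [φ.map_X, ← φ.map_u, ← φ.map_v, edist_iso, edist_iso]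
      map_u := φ.map_u
      map_v := φ.map_v }
  change (∑ i : E.V, ρ (E.withFeatures (distFeatures lab E)) i)
    = ∑ i : E'.V, ρ (E'.withFeatures (distFeatures lab E')) i
  exact Fintype.sum_equiv φ.iso.toEquiv _ _ fun i =>
    hρ _ _ _ _ fun t => (labelledWLColor_iso ψ t i).symm

/-! ### One block acting on a scalar hidden state -/

/-- The action of a normalization with unit gain and zero bias on the first of two coordinates
when the second one is `0`. -/
def Normalization.scalar : Normalization → ℝ → ℝ
  | .none, x => x
  | .layer ε _, x => x / 2 / Real.sqrt ((x / 2) ^ 2 + ε)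

/-- A second coordinate that is constantly `0` serves as a reference: centering the pair
`(x, 0)` gives `(x / 2, -x / 2)`, so layer normalization does not lose `x`. -/
theorem Normalization.apply_pair (nrm : Normalization) (x : ℝ) :
    nrm.apply ![1, 0] 0 ![x, 0] = ![nrm.scalar x, 0] := by
  cases nrm with
  | none => rfl
  | layer ε hε =>
    funext j
    have h1 : x - x / 2 = x / 2 := by ring
    have h2 : ((x / 2) ^ 2 + (x / 2) ^ 2) / 2 = (x / 2) ^ 2 := by ring
    fin_cases j <;> simp [Normalization.apply, Normalization.scalar, h1, h2]

theorem Normalization.scalar_bounds (nrm : Normalization) :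
    ∃ a b : ℝ, 0 < a ∧ 0 < b ∧
      ∀ x, 0 ≤ x → x ≤ 1 → a * x ≤ nrm.scalar x ∧ nrm.scalar x ≤ b * x := by
  cases nrm with
  | none => exact ⟨1, 1, one_pos, one_pos, fun x _ _ => by simp [Normalization.scalar]⟩
  | layer ε hε =>
    refine ⟨1 / 2 / Real.sqrt (1 + ε), 1 / 2 / Real.sqrt ε, by positivity, by positivity,
      fun x h0 h1 => ?_⟩
    simp only [Normalization.scalar]
    have e (s : ℝ) : 1 / 2 / s * x = x / 2 / s := by ring
    rw [e, e]
    constructor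
    · gcongr
      nlinarith
    · gcongr
      nlinarith [sq_nonneg (x / 2)]

theorem Normalization.scalar_injective (nrm : Normalization) :
    Function.Injective nrm.scalar := by
  cases nrm with
  | none => exact fun _ _ h => h
  | layer ε hε =>
    -- Up to scaling of the argument this is `sin ∘ arctan`.
    have key (x : ℝ) : x / 2 / Real.sqrt ((x / 2) ^ 2 + ε)
        = (x / (2 * Real.sqrt ε)) / Real.sqrt (1 + (x / (2 * Real.sqrt ε)) ^ 2) := by
      have hs : 0 < Real.sqrt ε := Real.sqrt_pos.mpr hε
      have : (x / 2) ^ 2 + ε = ε * (1 + (x / (2 * Real.sqrt ε)) ^ 2) := by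
        rw [div_pow _ (2 * _), mul_pow, Real.sq_sqrt hε.le]
        field_simp
        ring
      rw [this, Real.sqrt_mul hε.le]
      field_simp
    intro x y h
    simp only [Normalization.scalar] at h
    rw [key, key, ← Real.sin_arctan, ← Real.sin_arctan] at h
    have h1 := Real.injOn_sin (Set.Ioo_subset_Icc_self (Real.arctan_mem_Ioo _))
      (Set.Ioo_subset_Icc_self (Real.arctan_mem_Ioo _)) h
    have h2 := Real.arctan_injective h1
    have hs : 0 < Real.sqrt ε := Real.sqrt_pos.mpr hε
    field_simp at h2
    exact h2

/-- A block of hidden size `2`. Its only attention head has a constant query and the keys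
`R * c`, so that on hidden states `(c, 0)` it returns `κ` times a softmax mean of the `c`. The
feed-forward network computes `y ↦ -y + μ * -gelu (-(r * (y + b)))`, the first summand of which
cancels the skip connection. -/
def separatingBlock (R κ b r μ : ℝ) : BlockParams 2 where
  heads := 1
  dk := 1
  ff := 3
  WQ := fun _ => 0
  WK := fun _ => !![R; 0]
  WV := fun _ => !![1; 0]
  bQ := fun _ _ => 1
  bK := fun _ _ => 0
  bV := fun _ _ => 0
  WO := fun _ => ![κ, 0]
  bO := 0
  W₁ := !![1, -1, -r; 0, 0, 0]
  b₁ := ![0, 0, -(r * b)]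
  W₂ := !![-1, 0; 1, 0; -μ, 0]
  b₂ := 0
  γ₁ := ![1, 0]
  β₁ := 0
  γ₂ := ![1, 0]
  β₂ := 0
  WP := 0
  bP := 0

theorem separatingBlock_attention {τ : Type} [Fintype τ] (R κ b r μ : ℝ) {c : τ → ℝ}
    (hc : Function.Injective c) (t : τ) :
    (separatingBlock R κ b r μ).attention (fun s => ![c s, 0]) t
      = ![κ * softmaxMean R (Finset.univ.image c), 0] := by
  let H : Matrix τ (Fin 2) ℝ := fun s => ![c s, 0]
  have hK (s : τ) : (H * (!![R; 0] : Matrix (Fin 2) (Fin 1) ℝ)) s 0 = R * c s := by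
    rw [Matrix.mul_apply]
    simp [H, mul_comm]
  have hV (s : τ) : (H * (!![1; 0] : Matrix (Fin 2) (Fin 1) ℝ)) s 0 = c s := by
    rw [Matrix.mul_apply]
    simp [H]
  have hmean : softmaxMean R (Finset.univ.image c)
      = ∑ s, Real.exp (R * c s) / (∑ s', Real.exp (R * c s')) * c s := by
    rw [softmaxMean, Finset.sum_image hc.injOn, Finset.sum_image hc.injOn, Finset.sum_div]
    exact Finset.sum_congr rfl fun s _ => by ring
  funext j
  let logit (s : τ) : ℝ := (∑ k : Fin 1, ((H * (0 : Matrix (Fin 2) (Fin 1) ℝ)) t k + 1) *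
    ((H * (!![R; 0] : Matrix (Fin 2) (Fin 1) ℝ)) s k + 0)) / Real.sqrt (1 : ℕ)
  have hlogit (s : τ) : logit s = R * c s := by simp [logit, hK]
  change (∑ p : Fin 1 × Fin 1, (∑ s, Real.exp (logit s) / (∑ s', Real.exp (logit s')) *
    ((H * (!![1; 0] : Matrix (Fin 2) (Fin 1) ℝ)) s p.2 + 0)) * (![κ, 0] : Fin 2 → ℝ) j) + 0 = _
  simp only [Fintype.sum_prod_type, Fin.sum_univ_one, hlogit, hV, add_zero, ← hmean]
  fin_cases j <;> simp [mul_comm]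

theorem separatingBlock_feedForward (R κ b r μ y : ℝ) :
    (separatingBlock R κ b r μ).feedForward ![y, 0] = ![-y + μ * -gelu (-(r * (y + b))), 0] := by
  have h := gelu_sub_gelu_neg y
  have e : -(y * r) + -(r * b) = -(r * (y + b)) := by ring
  funext j
  change (∑ k : Fin 3, gelu ((∑ l : Fin 2, (![y, 0] : Fin 2 → ℝ) l *
      (!![1, -1, -r; 0, 0, 0] : Matrix (Fin 2) (Fin 3) ℝ) l k)
      + (![0, 0, -(r * b)] : Fin 3 → ℝ) k)
      * (!![-1, 0; 1, 0; -μ, 0] : Matrix (Fin 3) (Fin 2) ℝ) k j) + 0 = _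
  fin_cases j
  · simp [Fin.sum_univ_three, e]
    linarith
  · simp [Fin.sum_univ_three]

theorem separatingBlock_block (nrm : Normalization) {τ : Type} [Fintype τ] (R κ b r μ : ℝ)
    {c : τ → ℝ} (hc : Function.Injective c) (A : Matrix τ τ ℝ) (t : τ) :
    (separatingBlock R κ b r μ).block nrm A (fun s => ![c s, 0]) t 0
      = nrm.scalar (μ * -gelu (-(r *
          (nrm.scalar (c t + κ * softmaxMean R (Finset.univ.image c)) + b)))) := by
  have hadd (x y : ℝ) : (fun j => (![x, 0] : Fin 2 → ℝ) j + (![y, 0] : Fin 2 → ℝ) j)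
      = ![x + y, 0] := by
    funext j
    fin_cases j <;> simp
  have hWP : (separatingBlock R κ b r μ).WP = 0 := rfl
  have hbP : (separatingBlock R κ b r μ).bP = 0 := rfl
  have hγ₁ : (separatingBlock R κ b r μ).γ₁ = ![1, 0] := rfl
  have hβ₁ : (separatingBlock R κ b r μ).β₁ = 0 := rfl
  have hγ₂ : (separatingBlock R κ b r μ).γ₂ = ![1, 0] := rfl
  have hβ₂ : (separatingBlock R κ b r μ).β₂ = 0 := rfl
  simp only [BlockParams.block, BlockParams.transformer, hWP, hbP, Matrix.mul_zero,
    separatingBlock_attention R κ b r μ hc, hγ₁, hβ₁, hγ₂, hβ₂, hadd, nrm.apply_pair,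
    separatingBlock_feedForward]
  simp

/-! ### Token encodings determine the labelled graph -/

/-- The encoding of a token together with the features of its node. -/
def tokenVec (Nmax : ℕ) {f N : ℕ} (hN : 2 ≤ N) (G : SimpleGraph (Fin N)) (X : Fin N → Fin f → ℝ)
    (t : Token N) : Column Nmax ⊕ Fin f → ℝ :=
  Sum.elim (encode Nmax hN G t) (X (t.node hN))

/-- All vectors that can be token encodings of graphs with node features in `𝒳`. -/
def tokenVecs (Nmax : ℕ) {f : ℕ} (𝒳 : Set (Fin f → ℝ)) : Set (Column Nmax ⊕ Fin f → ℝ) :=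
  Set.image2 Sum.elim (Set.univ.pi fun _ => {0, 1}) 𝒳

theorem finite_tokenVecs (Nmax : ℕ) {f : ℕ} {𝒳 : Set (Fin f → ℝ)} (h : 𝒳.Finite) :
    (tokenVecs Nmax 𝒳).Finite :=
  (Set.Finite.pi fun _ => Set.toFinite _).image2 _ h

theorem tokenVec_mem {Nmax f N : ℕ} (hN : 2 ≤ N) (G : SimpleGraph (Fin N))
    {X : Fin N → Fin f → ℝ} {𝒳 : Set (Fin f → ℝ)} (hX : ∀ i, X i ∈ 𝒳) (t : Token N) :
    tokenVec Nmax hN G X t ∈ tokenVecs Nmax 𝒳 := by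
  refine ⟨_, fun col _ => ?_, _, hX (t.node hN), rfl⟩
  rcases col with (s | s) | s
  · simp only [encode]; split_ifs <;> simp
  · simp only [encode]; split_ifs <;> simp
  · rcases t with t | t <;> simp only [encode] <;> split_ifs <;> simp

section
variable {Nmax f N N' : ℕ} {hN : 2 ≤ N} {hN' : 2 ≤ N'} {G : SimpleGraph (Fin N)}
  {G' : SimpleGraph (Fin N')} {X : Fin N → Fin f → ℝ} {X' : Fin N' → Fin f → ℝ} {t : Token N}
  {t' : Token N'}

theorem node_eq_of_tokenVec_eq (hNmax : N ≤ Nmax)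
    (h : tokenVec Nmax hN G X t = tokenVec Nmax hN' G' X' t') :
    (t.node hN : ℕ) = t'.node hN' := by
  have := congrFun h (.inl (.inl (.inl ⟨t.node hN, (t.node hN).2.trans_le hNmax⟩)))
  by_contra hne
  simp [tokenVec, encode, hne] at this

theorem isLeft_eq_of_tokenVec_eq
    (h : tokenVec Nmax hN G X t = tokenVec Nmax hN' G' X' t') : t.isLeft = t'.isLeft := by
  have := congrFun h (.inl (.inr 0))
  rcases t with t | t <;> rcases t' with t' | t' <;> simp [tokenVec, encode] at this ⊢

theorem adj_of_tokenVec_eq (hNmax : N ≤ Nmax)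
    (h : tokenVec Nmax hN G X t = tokenVec Nmax hN' G' X' t') {a : Fin N} {a' : Fin N'}
    (ha : (a : ℕ) = a') : G.Adj (t.node hN) a ↔ G'.Adj (t'.node hN') a' := by
  have := congrFun h (.inl (.inl (.inr ⟨a, a.2.trans_le hNmax⟩)))
  have e1 : (∃ b : Fin N, (b : ℕ) = a ∧ G.Adj (t.node hN) b) ↔ G.Adj (t.node hN) a :=
    ⟨fun ⟨b, hb, h⟩ => Fin.ext hb ▸ h, fun h => ⟨a, rfl, h⟩⟩
  have e2 : (∃ b : Fin N', (b : ℕ) = a ∧ G'.Adj (t'.node hN') b) ↔ G'.Adj (t'.node hN') a' :=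
    ⟨fun ⟨b, hb, h⟩ => Fin.ext (hb.trans ha) ▸ h, fun h => ⟨a', ha.symm, h⟩⟩
  simp only [tokenVec, encode, Sum.elim_inl, e1, e2] at this
  by_cases h1 : G.Adj (t.node hN) a <;> by_cases h2 : G'.Adj (t'.node hN') a' <;> simp_all

theorem tokenVec_injective (hN : 2 ≤ N) (G : SimpleGraph (Fin N)) (X : Fin N → Fin f → ℝ)
    (hNmax : N ≤ Nmax) : Function.Injective (tokenVec Nmax hN G X) := by
  intro t t' h
  have h1 := node_eq_of_tokenVec_eq hNmax h
  have h2 := isLeft_eq_of_tokenVec_eq h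
  rcases t with t | t <;> rcases t' with t' | t' <;> simp [Token.node] at h1 h2 ⊢ <;>
    exact Fin.ext h1

theorem le_of_range_tokenVec_subset (hNmax : N ≤ Nmax)
    (h : Set.range (tokenVec Nmax hN G X) ⊆ Set.range (tokenVec Nmax hN' G' X')) : N ≤ N' := by
  -- The one-hot identifier of the last context token has to occur among the other encodings.
  obtain ⟨t', ht'⟩ := h ⟨.inl ⟨N - 1, by omega⟩, rfl⟩
  have h1 := node_eq_of_tokenVec_eq hNmax ht'.symm
  have h2 := (t'.node hN').2
  simp only [Token.node] at h1
  omega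

/-- The set of the token encodings determines the featured graph on `Fin N`, including `N`. -/
theorem labelled_eq_of_range_tokenVec_eq (hNmax : N ≤ Nmax) (hNmax' : N' ≤ Nmax)
    (h : Set.range (tokenVec Nmax hN G X) = Set.range (tokenVec Nmax hN' G' X')) :
    ∃ e : N = N', (∀ a b, G'.Adj (finCongr e a) (finCongr e b) ↔ G.Adj a b) ∧
      ∀ a, X' (finCongr e a) = X a := by
  obtain rfl : N = N' := le_antisymm (le_of_range_tokenVec_subset hNmax h.subset)
    (le_of_range_tokenVec_subset hNmax' h.superset)
  have key (a : Fin N) : tokenVec Nmax hN G X (.inl a) = tokenVec Nmax hN' G' X' (.inl a) := by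
    obtain ⟨t', ht'⟩ := h.subset ⟨.inl a, rfl⟩
    have h1 := node_eq_of_tokenVec_eq hNmax ht'.symm
    have h2 := isLeft_eq_of_tokenVec_eq ht'
    rcases t' with t' | t'
    · obtain rfl : a = t' := Fin.ext h1
      exact ht'.symm
    · simp at h2
  refine ⟨rfl, fun a b => (adj_of_tokenVec_eq hNmax (key a) rfl).symm, fun a => ?_⟩
  funext l
  simpa [tokenVec, Token.node] using (congrFun (key a) (.inr l)).symm

end

theorem relabelings_nonempty {f : ℕ} (L : Link f) : (relabelings L).Nonempty := by
  have h2 := L.two_le_card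
  let z : Fin (Fintype.card L.V) := ⟨0, by omega⟩
  let o : Fin (Fintype.card L.V) := ⟨1, by omega⟩
  let e₀ := Fintype.equivFin L.V
  -- Two swaps move `u` to the index `0` and then `v` to the index `1`.
  let e₁ := e₀.trans (Equiv.swap (e₀ L.u) z)
  let e₂ := e₁.trans (Equiv.swap (e₁ L.v) o)
  have hu : e₁ L.u = z := by simp [e₁]
  have hne : z ≠ e₁ L.v := fun h => L.ne (e₁.injective (hu.trans h))
  have hzo : z ≠ o := by simp [z, o]
  refine ⟨e₂, ?_⟩
  simp only [relabelings, Finset.mem_filter, Finset.mem_univ, true_and]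
  constructor
  · simp [e₂, hu, Equiv.swap_apply_of_ne_of_ne hne hzo, z]
  · simp [e₂, o]

theorem card_relabelings_le {f Nmax : ℕ} {L : Link f} (h : Fintype.card L.V ≤ Nmax) :
    ((relabelings L).card : ℝ) ≤ Nmax.factorial := by
  classical
  have : (relabelings L).card ≤ (Fintype.card L.V).factorial := by
    rw [← Fintype.card_equiv (Fintype.equivFin L.V)]
    exact (Finset.card_filter_le _ _).trans_eq (by rw [Finset.card_univ])
  exact_mod_cast this.trans (Nat.factorial_le h)

/-- The token encodings of a link relabelled by `π`. -/
def linkVec (Nmax : ℕ) {f : ℕ} (L : Link f) (π : L.V ≃ Fin (Fintype.card L.V)) :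
    Token (Fintype.card L.V) → Column Nmax ⊕ Fin f → ℝ :=
  tokenVec Nmax L.two_le_card (L.G.comap π.symm) (fun a => L.X (π.symm a))

/-- Two links with a common relabelling are isomorphic. -/
theorem nonempty_linkIso_of_range_linkVec_eq {f Nmax : ℕ} {L L' : Link f}
    (hL : Fintype.card L.V ≤ Nmax) (hL' : Fintype.card L'.V ≤ Nmax)
    {π : L.V ≃ Fin (Fintype.card L.V)} {π' : L'.V ≃ Fin (Fintype.card L'.V)}
    (hπ : π ∈ relabelings L) (hπ' : π' ∈ relabelings L')
    (h : Set.range (linkVec Nmax L π) = Set.range (linkVec Nmax L' π')) :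
    Nonempty (LinkIso L L') := by
  obtain ⟨e, hG, hX⟩ := labelled_eq_of_range_tokenVec_eq hL hL' h
  simp only [relabelings, Finset.mem_filter, Finset.mem_univ, true_and] at hπ hπ'
  refine ⟨{ iso := ⟨(π.trans (finCongr e)).trans π'.symm, fun {a b} => ?_⟩
            map_X := fun i => ?_
            map_u := ?_
            map_v := ?_ }⟩
  · simpa using hG (π a) (π b)
  · simpa using hX (π i)
  · change π'.symm (finCongr e (π L.u)) = L'.u
    rw [Equiv.symm_apply_eq]
    exact Fin.ext (by simp [hπ.1, hπ'.1])
  · change π'.symm (finCongr e (π L.v)) = L'.v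
    rw [Equiv.symm_apply_eq]
    exact Fin.ext (by simp [hπ.2, hπ'.2])

/-! ### The separating parameters -/

/-- The scalar code of a token vector under the weights `w`. -/
def code {Nmax f : ℕ} (w x : Column Nmax ⊕ Fin f → ℝ) : ℝ := ∑ i, x i * w i

/-- Some linear functional is injective on a finite set of vectors. -/
theorem exists_injOn_code {Nmax f : ℕ} {S : Set (Column Nmax ⊕ Fin f → ℝ)} (hS : S.Finite) :
    ∃ w, Set.InjOn (code w) S := by
  have : Finite S := hS
  obtain ⟨φ, hφ⟩ := Module.exists_dual_forall_apply_ne_zero (K := ℝ)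
    (fun p : {p : S × S // p.1 ≠ p.2} => (p.1.1 : Column Nmax ⊕ Fin f → ℝ) - p.1.2)
    (fun p => sub_ne_zero.mpr fun h => p.2 (Subtype.ext h))
  have hcode (x : Column Nmax ⊕ Fin f → ℝ) :
      code (fun i => φ fun j => if i = j then 1 else 0) x = φ x := by
    simp [code, LinearMap.pi_apply_eq_sum_univ φ x]
  refine ⟨fun i => φ fun j => if i = j then 1 else 0, fun x hx y hy h => ?_⟩
  by_contra hne
  refine hφ ⟨(⟨x, hx⟩, ⟨y, hy⟩), fun h => hne (congrArg Subtype.val h)⟩ ?_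
  rw [map_sub, ← hcode, ← hcode, h, sub_self]

/-- One `separatingBlock` on the hidden states `(code w x, 0)`, read out at the first
coordinate of the task token of `u`. -/
def separatingParams {Nmax f : ℕ} (w : Column Nmax ⊕ Fin f → ℝ) (R κ b r μ : ℝ) :
    PencilParams f Nmax where
  d := 2
  K := 1
  W₀ := fun col => ![w (.inl col), 0]
  WG := fun l => ![w (.inr l), 0]
  bG := 0
  blocks := fun _ => separatingBlock R κ b r μ
  head := ![1, 0, 0, 0]
  bhead := 0

/-- The set of the codes of all tokens of a relabelled link. -/
def codeSet {Nmax f : ℕ} (w : Column Nmax ⊕ Fin f → ℝ) (L : Link f)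
    (π : L.V ≃ Fin (Fintype.card L.V)) : Finset ℝ :=
  Finset.univ.image fun t => code w (linkVec Nmax L π t)

/-- The normalized output of the attention head at the task token of `u`. -/
def attended {Nmax f : ℕ} (nrm : Normalization) (w : Column Nmax ⊕ Fin f → ℝ) (R κ : ℝ)
    (L : Link f) (π : L.V ≃ Fin (Fintype.card L.V)) : ℝ :=
  nrm.scalar (code w (linkVec Nmax L π (.inr 0)) + κ * softmaxMean R (codeSet w L π))

theorem separatingParams_eval {Nmax f : ℕ} (m : ℕ) (nrm : Normalization)
    {w : Column Nmax ⊕ Fin f → ℝ} (R κ b r μ : ℝ) (L : Link f)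
    (hw : ∀ π, Function.Injective fun t => code w (linkVec Nmax (L.enclosing m) π t)) :
    (pencilModel m nrm (separatingParams w R κ b r μ)).eval L = fun _ =>
      (∑ π ∈ relabelings (L.enclosing m), nrm.scalar
        (μ * -gelu (-(r * (attended nrm w R κ (L.enclosing m) π + b))))) /
        (relabelings (L.enclosing m)).card := by
  classical
  set E := L.enclosing m
  have hforward (π : E.V ≃ Fin (Fintype.card E.V)) :
      (separatingParams w R κ b r μ).forward nrm E.two_le_card (E.G.comap π.symm)
        (fun a => E.X (π.symm a)) (.inr 0) (0 : Fin 2)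
      = nrm.scalar (μ * -gelu (-(r * (attended nrm w R κ E π + b)))) := by
    have := separatingBlock_block nrm R κ b r μ (hw π)
      (reconstruct (encode Nmax E.two_le_card (E.G.comap π.symm))) (.inr 0)
    rw [attended, codeSet, ← this]
    change BlockParams.block nrm (separatingBlock R κ b r μ)
      (reconstruct (encode Nmax E.two_le_card (E.G.comap π.symm)))
      (fun t j => (encode Nmax E.two_le_card (E.G.comap π.symm) *
          (Matrix.of fun col => ![w (.inl col), 0] : Matrix (Column Nmax) (Fin 2) ℝ)) t j
        + ((∑ l, E.X (π.symm (t.node E.two_le_card)) l * (![w (.inr l), 0] : Fin 2 → ℝ) j) + 0))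
      (.inr 0) 0 = _
    congr 2
    funext t j
    fin_cases j
    · simp [code, linkVec, tokenVec, Matrix.mul_apply, Fintype.sum_sum_type]
    · simp [Matrix.mul_apply]
  funext k
  have hpool : (separatingParams w R κ b r μ).pooled nrm E E.u (0 : Fin 2)
      = (∑ π ∈ relabelings E, nrm.scalar
        (μ * -gelu (-(r * (attended nrm w R κ E π + b))))) / (relabelings E).card := by
    simp only [PencilParams.pooled, readToken, if_true]
    exact congrArg (· / ((relabelings E).card : ℝ)) (Finset.sum_congr rfl fun π _ => hforward π)
  rw [← hpool]
  change (∑ j : Fin 4, (![1, 0, 0, 0] : Fin 4 → ℝ) j * (∑ i : E.V, Fin.append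
    (fun j : Fin 2 => if i = E.u then (separatingParams w R κ b r μ).pooled nrm E i j else 0)
    (fun j : Fin 2 => if i = E.v then (separatingParams w R κ b r μ).pooled nrm E i j else 0))
      j) + 0 = _
  rw [Fin.sum_univ_four]
  simp only [Finset.sum_apply]
  have happ (x y : Fin 2 → ℝ) : (Fin.append x y : Fin 4 → ℝ) 0 = x 0 := Fin.append_left x y 0
  simp [happ]

/-- The codes `code w` are injective on the possible token encodings, `R` is a temperature that
separates the code sets, `κ` keeps them apart in the presence of the skip connection, `b` makes all
values positive, `r` spreads them over different orders of magnitude, and `μ` scales them into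
`[0, 1]`, where the normalization is comparable to a linear map. In `out c A`, the number `c` is the
code of the token at which the output is read, and `A` is the set of all codes. -/
theorem exists_separatingParams (f Nmax : ℕ) (nrm : Normalization) {𝒳 : Set (Fin f → ℝ)}
    (h𝒳 : 𝒳.Finite) (M : ℝ) :
    ∃ (w : Column Nmax ⊕ Fin f → ℝ) (R κ b r μ : ℝ), Set.InjOn (code w) (tokenVecs Nmax 𝒳) ∧
      ∀ Ω : Finset ℝ, (Ω : Set ℝ) = code w '' tokenVecs Nmax 𝒳 →
      let y := fun (c : ℝ) (A : Finset ℝ) => nrm.scalar (c + κ * softmaxMean R A)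
      let out := fun c A => nrm.scalar (μ * -gelu (-(r * (y c A + b))))
      ∀ c ∈ Ω, ∀ A ⊆ Ω, A.Nonempty → 0 < out c A ∧ ∀ c' ∈ Ω, ∀ A' ⊆ Ω, A'.Nonempty → A ≠ A' →
        M * out c A < out c' A' ∨ M * out c' A' < out c A := by
  classical
  obtain ⟨w, hw⟩ := exists_injOn_code (finite_tokenVecs Nmax h𝒳)
  obtain ⟨Ω, hΩ⟩ := ((finite_tokenVecs Nmax h𝒳).image (code w)).exists_finset_coe
  obtain ⟨R, hR⟩ := exists_softmaxMean_injOn Ω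
  -- The admissible pairs of the code of the task token of `u` and a code set.
  let S : Finset (ℝ × Finset ℝ) := Ω ×ˢ Ω.powerset.filter Finset.Nonempty
  have hS {p : ℝ × Finset ℝ} : p ∈ S ↔ p.1 ∈ Ω ∧ p.2 ⊆ Ω ∧ p.2.Nonempty := by simp [S]
  -- For given token codes, two distinct code sets are confused by at most one value of `κ`.
  obtain ⟨κ, hκ⟩ : ∃ κ : ℝ, ∀ p ∈ S, ∀ q ∈ S, p.2 ≠ q.2 →
      p.1 + κ * softmaxMean R p.2 ≠ q.1 + κ * softmaxMean R q.2 := by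
    let bad := (S ×ˢ S).image fun z =>
      (z.2.1 - z.1.1) / (softmaxMean R z.1.2 - softmaxMean R z.2.2)
    obtain ⟨κ, hκ⟩ := Infinite.exists_notMem_finset bad
    refine ⟨κ, fun p hp q hq hpq h => hκ ?_⟩
    refine Finset.mem_image.mpr ⟨(p, q), Finset.mk_mem_product hp hq, ?_⟩
    have hne : softmaxMean R p.2 - softmaxMean R q.2 ≠ 0 := sub_ne_zero.mpr fun h =>
      hpq (hR _ (hS.mp hp).2.1 _ (hS.mp hq).2.1 (hS.mp hp).2.2 (hS.mp hq).2.2 h)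
    rw [div_eq_iff hne]
    linarith
  let y (p : ℝ × Finset ℝ) : ℝ := nrm.scalar (p.1 + κ * softmaxMean R p.2)
  have hy : ∀ p ∈ S, ∀ q ∈ S, p.2 ≠ q.2 → y p ≠ y q := fun p hp q hq hpq h =>
    hκ p hp q hq hpq (nrm.scalar_injective h)
  obtain ⟨b, hb⟩ : ∃ b : ℝ, ∀ p ∈ S, 0 < y p + b := by
    refine ⟨1 + ∑ p ∈ S, |y p|, fun p hp => ?_⟩
    have h1 := Finset.single_le_sum (f := fun p => |y p|) (fun _ _ => abs_nonneg _) hp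
    have h2 := neg_abs_le (y p)
    linarith
  obtain ⟨α, β, hα, hβ, hαβ⟩ := nrm.scalar_bounds
  obtain ⟨r, hr0, hr⟩ : ∃ r : ℝ, 0 < r ∧ ∀ p ∈ S, ∀ q ∈ S, y p < y q →
      |M| * β / α * -gelu (-(r * (y q + b))) < -gelu (-(r * (y p + b))) := by
    refine ((Filter.eventually_gt_atTop 0).and ?_).exists
    refine S.eventually_all.mpr fun p hp => S.eventually_all.mpr fun q hq => ?_
    by_cases hpq : y p < y q
    · filter_upwards [eventually_mul_gelu_neg_lt (|M| * β / α) (hb p hp)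
        (add_lt_add_left hpq b)] with r hr _ using hr
    · exact Filter.Eventually.of_forall fun _ h => absurd h hpq
  let T (p : ℝ × Finset ℝ) : ℝ := -gelu (-(r * (y p + b)))
  have hT : ∀ p ∈ S, 0 < T p := fun p hp => gelu_neg_pos (mul_pos hr0 (hb p hp))
  obtain ⟨μ, hμ0, hμ⟩ : ∃ μ : ℝ, 0 < μ ∧ ∀ p ∈ S, μ * T p ≤ 1 := by
    have hsum : 0 ≤ ∑ p ∈ S, T p := Finset.sum_nonneg fun p hp => (hT p hp).le
    refine ⟨(1 + ∑ p ∈ S, T p)⁻¹, by positivity, fun p hp => ?_⟩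
    have h1 := Finset.single_le_sum (f := T) (fun p hp => (hT p hp).le) hp
    rw [inv_mul_le_iff₀ (by positivity)]
    linarith
  have hbd (p) (hp : p ∈ S) := hαβ (μ * T p) (mul_pos hμ0 (hT p hp)).le (hμ p hp)
  have hlt : ∀ p ∈ S, ∀ q ∈ S, y p < y q → M * nrm.scalar (μ * T q) < nrm.scalar (μ * T p) := by
    intro p hp q hq hpq
    have h1 := hr p hp q hq hpq
    have hq0 : 0 ≤ nrm.scalar (μ * T q) :=
      (mul_pos hα (mul_pos hμ0 (hT q hq))).le.trans (hbd q hq).1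
    calc M * nrm.scalar (μ * T q) ≤ |M| * nrm.scalar (μ * T q) :=
          mul_le_mul_of_nonneg_right (le_abs_self M) hq0
      _ ≤ |M| * (β * (μ * T q)) := mul_le_mul_of_nonneg_left (hbd q hq).2 (abs_nonneg M)
      _ = α * μ * (|M| * β / α * T q) := by field_simp
      _ < α * μ * T p := mul_lt_mul_of_pos_left h1 (mul_pos hα hμ0)
      _ = α * (μ * T p) := mul_assoc _ _ _
      _ ≤ nrm.scalar (μ * T p) := (hbd p hp).1
  refine ⟨w, R, κ, b, r, μ, hw, fun Ω' hΩ' => ?_⟩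
  obtain rfl : Ω' = Ω := Finset.coe_injective (hΩ'.trans hΩ.symm)
  intro y' out c hc A hA hA0
  have hp : (c, A) ∈ S := hS.mpr ⟨hc, hA, hA0⟩
  refine ⟨(mul_pos hα (mul_pos hμ0 (hT _ hp))).trans_le (hbd _ hp).1,
    fun c' hc' A' hA' hA0' hne => ?_⟩
  have hq : (c', A') ∈ S := hS.mpr ⟨hc', hA', hA0'⟩
  rcases lt_or_gt_of_ne (hy _ hp _ hq hne) with h | h
  · exact .inr (hlt _ hp _ hq h)
  · exact .inl (hlt _ hq _ hp h)

/-- One parameter setting of PENCIL gives different outputs to any two links with nonisomorphic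
enclosing subgraphs, of bounded size and with features in a given finite set. -/
theorem exists_pencilModel_eval_ne (f Nmax m : ℕ) (nrm : Normalization) {𝒳 : Set (Fin f → ℝ)}
    (h𝒳 : 𝒳.Finite) :
    ∃ P : PencilParams f Nmax, ∀ L ∈ withinBudget f Nmax m ∩ featuresIn m 𝒳,
      ∀ L' ∈ withinBudget f Nmax m ∩ featuresIn m 𝒳,
        ¬ Nonempty (LinkIso (L.enclosing m) (L'.enclosing m)) →
        (pencilModel m nrm P).eval L ≠ (pencilModel m nrm P).eval L' := by
  classical
  obtain ⟨w, R, κ, b, r, μ, hw, hsep⟩ :=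
    exists_separatingParams f Nmax nrm h𝒳 (Nmax.factorial : ℝ)
  obtain ⟨Ω, hΩ⟩ := ((finite_tokenVecs Nmax h𝒳).image (code w)).exists_finset_coe
  replace hsep := hsep Ω hΩ
  have hmem {L : Link f} (hL : L ∈ featuresIn m 𝒳) (π t) :
      linkVec Nmax (L.enclosing m) π t ∈ tokenVecs Nmax 𝒳 :=
    tokenVec_mem _ _ (fun _ => hL _) t
  have hcode {L : Link f} (hL : L ∈ featuresIn m 𝒳) (π t) :
      code w (linkVec Nmax (L.enclosing m) π t) ∈ Ω := by
    rw [← Finset.mem_coe, hΩ]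
    exact ⟨_, hmem hL π t, rfl⟩
  have hsub {L : Link f} (hL : L ∈ featuresIn m 𝒳) (π) :
      codeSet w (L.enclosing m) π ⊆ Ω := by
    simpa [codeSet, Finset.image_subset_iff] using hcode hL π
  have hne {L : Link f} (π) : (codeSet w (L.enclosing m) π).Nonempty :=
    ⟨_, Finset.mem_image_of_mem _ (Finset.mem_univ (.inr 0))⟩
  have hinj {L : Link f} (hL : L ∈ withinBudget f Nmax m ∩ featuresIn m 𝒳) (π) :
      Function.Injective fun t => code w (linkVec Nmax (L.enclosing m) π t) := fun t t' h =>
    tokenVec_injective _ _ _ hL.1 (hw (hmem hL.2 π t) (hmem hL.2 π t') h)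
  refine ⟨separatingParams w R κ b r μ, fun L hL L' hL' hiso h => ?_⟩
  rw [separatingParams_eval m nrm R κ b r μ L (hinj hL),
    separatingParams_eval m nrm R κ b r μ L' (hinj hL')] at h
  refine average_ne_of_separated (relabelings_nonempty _) (relabelings_nonempty _)
    (card_relabelings_le hL.1) (card_relabelings_le hL'.1)
    (fun π _ => (hsep _ (hcode hL.2 π (.inr 0)) _ (hsub hL.2 π) (hne π)).1)
    (fun π _ => (hsep _ (hcode hL'.2 π (.inr 0)) _ (hsub hL'.2 π) (hne π)).1)
    (fun π hπ π' hπ' => (hsep _ (hcode hL.2 π (.inr 0)) _ (hsub hL.2 π) (hne π)).2 _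
      (hcode hL'.2 π' (.inr 0)) _ (hsub hL'.2 π') (hne π') fun hA => hiso ?_)
    (congrFun h (0 : Fin 1))
  refine nonempty_linkIso_of_range_linkVec_eq (Nmax := Nmax) hL.1 hL'.1 hπ hπ' ?_
  refine (hw.image_eq_image_iff (Set.range_subset_iff.mpr (hmem hL.2 π))
    (Set.range_subset_iff.mpr (hmem hL'.2 π'))).mp ?_
  rw [← Set.range_comp, ← Set.range_comp]
  have := congrArg (fun s : Finset ℝ => (s : Set ℝ)) hA
  simpa [codeSet, Function.comp_def] using this

/-- To be not less expressive than SEAL, it is enough to separate nonisomorphic enclosing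
subgraphs. -/
theorem notLessExpressive_of_eval_ne {f m : ℕ} {𝒜 : Set (FrameworkModel f)} {D : Set (Link f)}
    (h : ∀ L ∈ D, ∀ L' ∈ D, ¬ Nonempty (LinkIso (L.enclosing m) (L'.enclosing m)) →
      ∃ M ∈ 𝒜, M.eval L ≠ M.eval L') :
    NotLessExpressive 𝒜 (sealFamily f m) D := by
  rintro L hL L' hL' ⟨_, ⟨lab, e, ρ, hρ, rfl⟩, hM⟩
  exact h L hL L' hL' fun ⟨φ⟩ => hM (sealModel_eval_eq_of_linkIso hρ φ)

end PencilLink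

end

theorem mainTheorem6 (f Nmax m : ℕ) (nrm : PencilLink.Normalization) :
    PencilLink.NotLessExpressive (PencilLink.pencilFamily f Nmax m nrm)
        (PencilLink.sealFamily f m) (PencilLink.withinBudget f Nmax m) ∧
      ∀ 𝒳 : Set (Fin f → ℝ), 𝒳.Finite →
        ∃ P : PencilLink.PencilParams f Nmax,
          PencilLink.NotLessExpressive {PencilLink.pencilModel m nrm P}
            (PencilLink.sealFamily f m)
            (PencilLink.withinBudget f Nmax m ∩ PencilLink.featuresIn m 𝒳) := by
  constructor
  · refine PencilLink.notLessExpressive_of_eval_ne fun L hL L' hL' hiso => ?_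
    obtain ⟨P, hP⟩ := PencilLink.exists_pencilModel_eval_ne f Nmax m nrm
      ((Set.finite_range (L.enclosing m).X).union (Set.finite_range (L'.enclosing m).X))
    exact ⟨_, ⟨P, rfl⟩, hP L ⟨hL, fun i => .inl ⟨i, rfl⟩⟩ L' ⟨hL', fun i => .inr ⟨i, rfl⟩⟩ hiso⟩
  · intro 𝒳 h𝒳
    obtain ⟨P, hP⟩ := PencilLink.exists_pencilModel_eval_ne f Nmax m nrm h𝒳
    exact ⟨P, PencilLink.notLessExpressive_of_eval_ne fun L hL L' hL' hiso =>
      ⟨_, rfl, hP L hL L' hL' hiso⟩⟩
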